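/- Let $S$ and $A$ be finite nonempty sets (states and actions), let $r:S\times A\to\mathbb R$ be a reward function, and let $\Delta(X)$ denote the probability distributions on a finite set $X$. Let $\mathcal Q\subseteq\Delta(A)$ contain every point mass $\delta_a$, $a\in A$, and let $\mathcal P$ be a nonempty set of transition kernels $p:S\times A\to\Delta(S)$. For $p\in\mathcal P$ and $d:S\to\mathcal Q$, let $p_d$ be the stochastic matrix $p_d(s'|s)=\sum_a p(s'|s,a)\,d(a|s)$. The kernel $p$ is weakly communicating if there is $C\subseteq S$ such that for all $s,s'\in C$ there are $d:S\to\mathcal Q$ and $N\ge1$ with $p_d^N(s'|s)>0$, and every $s\notin C$ is transient (i.e. $\sum_{n\ge 0} p_d^n(s|s)<\infty$) for the chain $p_d$, for every $d:S\to\mathcal Q$. Let $\alpha_p:S\to\mathbb R$ be the gain part of a solution $(\alpha_p,v_p)$ of the multichain Bellman equation $$\alpha_p(s)=\max_{a\in A}\sum_{s'}p(s'|s,a)\alpha_p(s'),\qquad v_p(s)=\max_{a\in A}\Big\{r(s,a)-\alpha_p(s)+\sum_{s'}p(s'|s,a)v_p(s')\Big\},\quad s\in S,$$ and put $\alpha^*(\mu)=\inf_{p\in\mathcal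 P}\sum_s\mu(s)\alpha_p(s)$ for $\mu\in\Delta(S)$. Assume that $\mathcal P$ is compact (for entrywise convergence of kernels) and that every $p\in\mathcal P$ is weakly communicating. Then: 1. For every $p\in\mathcal P$ the multichain Bellman equation has a solution, and $\alpha_p$ is the same for all solutions. Moreover $\alpha_p$ does not depend on the state, and its constant value is the unique $g\in\mathbb R$ for which $v(s)=\max_a\{r(s,a)-g+\sum_{s'}p(s'|s,a)v(s')\}$, $s\in S$, has a solution $v:S\to\mathbb R$. 2. The map $p\mapsto\alpha_p$ is continuous on $\mathcal P$. 3. There is a worst-case kernel $p^*\in\mathcal P$: $\alpha_{p^*}=\min_{p\in\mathcal P}\alpha_p$, and for every $\mu\in\Delta(S)$ the infimum defining $\alpha^*(\mu)$ is attained at $p^*$, i.e. $\sum_s\mu(s)\alpha_{p^*}(s)=\alpha^*(\mu)=\min_{p\in\mathcal P}\sum_s\mu(s)\alpha_p(s)$. -/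

import Mathlib

noncomputable section

namespace RobustMDP

/-- Controlled transition kernels `p(s' | s, a)`, written `p s a s'`, on finite state and action
spaces.  The type carries the product topology, i.e. that of entrywise convergence. -/
abbrev Kernel (S A : Type*) [Fintype S] : Type _ := S → A → stdSimplex ℝ S

variable {S A : Type*} [Fintype S] [Fintype A]

/-- The one-step matrix `p_Δ(s' | s) = ∑ a, p(s' | s, a) Δ(a | s)` of a stationary randomized
decision rule `Δ`. -/
def policyMatrix (p : Kernel S A) (Δ : S → stdSimplex ℝ A) : Matrix S S ℝ :=
  Matrix.of fun s s' => ∑ a, p s a s' * Δ s a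

/-- A state of a finite Markov chain is transient when the expected number of visits
`∑ n, P^n(s | s)` to it, starting from it, is finite. -/
def IsTransient [DecidableEq S] (P : Matrix S S ℝ) (s : S) : Prop :=
  Summable fun n : ℕ => (P ^ n) s s

/-- Weak communication of a kernel, relative to the set `Q` of admissible action distributions. -/
def IsWeaklyCommunicating [DecidableEq S] (Q : Set (stdSimplex ℝ A)) (p : Kernel S A) : Prop :=
  ∃ C : Set S,
    (∀ s ∈ C, ∀ s' ∈ C, ∃ Δ : S → stdSimplex ℝ A, (∀ x, Δ x ∈ Q) ∧
      ∃ N : ℕ, 1 ≤ N ∧ 0 < (policyMatrix p Δ ^ N) s s') ∧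
    ∀ s ∉ C, ∀ Δ : S → stdSimplex ℝ A, (∀ x, Δ x ∈ Q) → IsTransient (policyMatrix p Δ) s

/-- `(α, v)` solves the multichain Bellman equation
`α(s) = max_a ∑ p(s'|s,a) α(s')`, `v(s) = max_a {r(s,a) - α(s) + ∑ p(s'|s,a) v(s')}`. -/
def SolvesMultichain [Nonempty A] (r : S → A → ℝ) (p : Kernel S A) (α v : S → ℝ) : Prop :=
  ∀ s,
    α s = Finset.univ.sup' Finset.univ_nonempty (fun a : A => ∑ s', p s a s' * α s') ∧
    v s = Finset.univ.sup' Finset.univ_nonempty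
      (fun a : A => r s a - α s + ∑ s', p s a s' * v s')

/-- `(g, v)` solves the constant-gain Bellman equation
`v(s) = max_a {r(s,a) - g + ∑ p(s'|s,a) v(s')}`. -/
def SolvesConstantGain [Nonempty A] (r : S → A → ℝ) (p : Kernel S A) (g : ℝ) (v : S → ℝ) : Prop :=
  ∀ s, v s = Finset.univ.sup' Finset.univ_nonempty
    (fun a : A => r s a - g + ∑ s', p s a s' * v s')

open Classical in
/-- The optimal gain `α_p`: the gain part of a solution `(α_p, v_p)` of the multichain Bellman
equation (a default value if there is no solution). -/
def optimalGain [Nonempty A] (r : S → A → ℝ) (p : Kernel S A) : S → ℝ :=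
  if h : ∃ α : S → ℝ, ∃ v : S → ℝ, SolvesMultichain r p α v then h.choose else 0

/-- `∑ s, μ(s) α_p(s)`. -/
def meanGain [Nonempty A] (r : S → A → ℝ) (μ : stdSimplex ℝ S) (p : Kernel S A) : ℝ :=
  ∑ s, μ s * optimalGain r p s

/-- `α*(μ) = inf_{p ∈ U} ∑ s, μ(s) α_p(s)`. -/
def robustGain [Nonempty A] (r : S → A → ℝ) (U : Set (Kernel S A)) (μ : stdSimplex ℝ S) : ℝ :=
  sInf (meanGain r μ '' U)

end RobustMDP

end

/-!
Everything rests on a rigidity property of a weakly communicating kernel: a function `α` with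
`α s = max_a ∑ s', p s a s' * α s'` is constant (`eq_of_isWeaklyCommunicating`). Every finite
stochastic matrix leads from each state to a non-transient one (`exists_not_isTransient`), which
for an admissible policy matrix must lie in the communicating class `C`. Following a greedy policy
from a maximum of `α`, and any policy from a minimum of `α`, produces points of `C` at which `α`
takes its maximum and its minimum. As `α` is superharmonic for every policy and any two points of
`C` communicate, the two values agree.

*Existence.* For a discount factor `β < 1` the discounted Bellman operator is a contraction, and its
fixed point, centred at a reference state, solves `h = max_a {r - g + β P_a h}` with `|g|` bounded
independently of `β`. After rescaling `h` and the rewards by `κ = 1 / max 1 ‖h‖`, these solutions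
lie in a fixed compact set, so there is one at `β = 1` as well (`exists_rescaled_solution`). There
`κ ≠ 0`, since for `κ = 0` the limit would be a function as in the rigidity property which vanishes
at the reference state but has norm one. Dividing by `κ` solves the constant-gain equation.

*Uniqueness and continuity.* A maximum principle (`gain_le_gain`) shows that a subsolution of the
constant-gain equation has gain at most that of any supersolution. This gives uniqueness of the
gain and, combined with rigidity, uniqueness for the multichain equation. A solution `v` for `p`
is an approximate solution for `p'`, with error at most `∑ s a, |∑ s', (p' - p) s a s' * v s'|`, so
the same principle bounds the change of the gain by this quantity, which tends to zero as `p' → p`.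
The worst-case kernel is then a minimizer of a continuous function on a compact set.
-/

namespace RobustMDP

open Finset Matrix Filter Topology

/-! ### Finite maxima and averages -/

section Aux

variable {S A : Type*} [Fintype S] [Fintype A]

lemma eq_univ_sup'_iff [Nonempty A] {x : ℝ} {f : A → ℝ} :
    x = univ.sup' univ_nonempty f ↔ (∀ a, f a ≤ x) ∧ ∃ a, x = f a := by
  constructor
  · rintro rfl
    refine ⟨fun a => le_sup' f (mem_univ a), ?_⟩
    obtain ⟨a, -, ha⟩ := exists_mem_eq_sup' univ_nonempty f
    exact ⟨a, ha⟩
  · rintro ⟨h, a, ha⟩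
    refine le_antisymm ?_ (sup'_le _ _ fun a _ => h a)
    rw [ha]
    exact le_sup' f (mem_univ a)

lemma univ_sup'_le_add [Nonempty A] {f g : A → ℝ} {c : ℝ} (h : ∀ a, f a ≤ g a + c) :
    univ.sup' univ_nonempty f ≤ univ.sup' univ_nonempty g + c :=
  sup'_le _ _ fun a _ => (h a).trans (by gcongr; exact le_sup' g (mem_univ a))

lemma abs_univ_sup'_sub_le [Nonempty A] {f g : A → ℝ} {c : ℝ} (h : ∀ a, |f a - g a| ≤ c) :
    |univ.sup' univ_nonempty f - univ.sup' univ_nonempty g| ≤ c := by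
  rw [abs_sub_le_iff]
  constructor
  · have := univ_sup'_le_add (f := f) (g := g) (c := c)
      fun a => by linarith [(abs_sub_le_iff.1 (h a)).1]
    linarith
  · have := univ_sup'_le_add (f := g) (g := f) (c := c)
      fun a => by linarith [(abs_sub_le_iff.1 (h a)).2]
    linarith

lemma average_const (q : stdSimplex ℝ S) (c : ℝ) : ∑ s, q s * c = c := by
  rw [← sum_mul, stdSimplex.sum_eq_one, one_mul]

lemma average_mono (q : stdSimplex ℝ S) {v w : S → ℝ} (h : ∀ s, v s ≤ w s) :
    ∑ s, q s * v s ≤ ∑ s, q s * w s :=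
  sum_le_sum fun s _ => mul_le_mul_of_nonneg_left (h s) (stdSimplex.zero_le q s)

lemma average_le (q : stdSimplex ℝ S) {v : S → ℝ} {c : ℝ} (h : ∀ s, v s ≤ c) :
    ∑ s, q s * v s ≤ c :=
  (average_mono q h).trans_eq (average_const q c)

lemma abs_average_le (q : stdSimplex ℝ S) {v : S → ℝ} {c : ℝ} (h : ∀ s, |v s| ≤ c) :
    |∑ s, q s * v s| ≤ c := by
  refine abs_le'.2 ⟨average_le q fun s => (abs_le'.1 (h s)).1, ?_⟩
  rw [← sum_neg_distrib]
  simp_rw [← mul_neg]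
  exact average_le q fun s => (abs_le'.1 (h s)).2

end Aux

/-! ### Stochastic matrices and transience -/

section Chain

variable {S : Type*} [Fintype S] [DecidableEq S] {P : Matrix S S ℝ}

/-- The expected number of visits to `t` in the first `N` steps is largest when the chain starts
at `t`. -/
lemma sum_pow_apply_le (hP : P ∈ rowStochastic ℝ S) (t : S) (N : ℕ) (s : S) :
    ∑ n ∈ range N, (P ^ n) s t ≤ ∑ n ∈ range N, (P ^ n) t t := by
  induction N generalizing s with
  | zero => simp
  | succ N ih =>
    rcases eq_or_ne s t with rfl | hst
    · rfl
    -- Conditioning on the first step: from `s ≠ t` the visit at time zero does not count.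
    calc ∑ n ∈ range (N + 1), (P ^ n) s t
        = ∑ x, P s x * ∑ n ∈ range N, (P ^ n) x t := by
          rw [sum_range_succ', pow_zero, one_apply_ne hst, add_zero]
          simp_rw [pow_succ', mul_apply, mul_sum]
          exact sum_comm
      _ ≤ ∑ x, P s x * ∑ n ∈ range N, (P ^ n) t t :=
          sum_le_sum fun x _ => mul_le_mul_of_nonneg_left (ih x) (hP.1 s x)
      _ = ∑ n ∈ range N, (P ^ n) t t := by
          rw [← sum_mul, sum_row_of_mem_rowStochastic hP, one_mul]
      _ ≤ ∑ n ∈ range (N + 1), (P ^ n) t t := by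
          rw [sum_range_succ]
          exact le_add_of_nonneg_right ((pow_mem hP N).1 t t)

lemma IsTransient.summable_apply (hP : P ∈ rowStochastic ℝ S) {t : S} (ht : IsTransient P t)
    (s : S) : Summable fun n : ℕ => (P ^ n) s t :=
  summable_of_sum_range_le (fun n => (pow_mem hP n).1 s t) fun N =>
    (sum_pow_apply_le hP t N s).trans
      (ht.sum_le_tsum (range N) fun n _ => (pow_mem hP n).1 t t)

lemma exists_not_isTransient (hP : P ∈ rowStochastic ℝ S) (s : S) :
    ∃ t, ¬ IsTransient P t ∧ ∃ n : ℕ, 0 < (P ^ n) s t := by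
  by_contra! h
  have hsum : ∀ t, Summable fun n : ℕ => (P ^ n) s t := by
    intro t
    by_cases ht : IsTransient P t
    · exact ht.summable_apply hP s
    · have h0 : (fun n : ℕ => (P ^ n) s t) = 0 :=
        funext fun n => le_antisymm (h t ht n) ((pow_mem hP n).1 s t)
      rw [h0]
      exact summable_zero
  have h1 : Summable fun _ : ℕ => (1 : ℝ) := by
    convert summable_sum (s := univ) fun t _ => hsum t using 2 with n
    exact (sum_row_of_mem_rowStochastic (pow_mem hP n) s).symm
  exact one_ne_zero ((summable_const_iff _).1 h1)

lemma pow_mulVec_le (hP : P ∈ rowStochastic ℝ S) {α : S → ℝ} (h : ∀ s, (P *ᵥ α) s ≤ α s)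
    (n : ℕ) (s : S) : (P ^ n *ᵥ α) s ≤ α s := by
  induction n generalizing s with
  | zero => simp
  | succ n ih =>
    rw [pow_succ', ← mulVec_mulVec]
    exact (sum_le_sum fun x _ => mul_le_mul_of_nonneg_left (ih x) (hP.1 s x)).trans (h s)

/-- A superharmonic function takes its minimum on every state that can be reached from a
minimum. -/
lemma eq_of_superharmonic_of_pos (hP : P ∈ rowStochastic ℝ S) {α : S → ℝ}
    (h : ∀ s, (P *ᵥ α) s ≤ α s) {s t : S} (hmin : ∀ x, α s ≤ α x) {n : ℕ}
    (hpos : 0 < (P ^ n) s t) : α t = α s := by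
  have hPn := pow_mem hP n
  have h0 : ∑ x, (P ^ n) s x * (α x - α s) ≤ 0 := by
    have := pow_mulVec_le hP h n s
    simp only [mulVec, dotProduct] at this
    simp_rw [mul_sub]
    rw [sum_sub_distrib, ← sum_mul, sum_row_of_mem_rowStochastic hPn]
    linarith
  have h1 : (P ^ n) s t * (α t - α s) ≤ 0 :=
    (single_le_sum (f := fun x => (P ^ n) s x * (α x - α s))
      (fun x _ => mul_nonneg (hPn.1 s x) (sub_nonneg.2 (hmin x))) (mem_univ t)).trans h0
  have h2 := hmin t
  nlinarith

end Chain

/-! ### Rigidity for weakly communicating kernels -/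

section Rigidity

variable {S A : Type*} [Fintype S] [Fintype A]

lemma policyMatrix_mulVec (p : Kernel S A) (d : S → stdSimplex ℝ A) (α : S → ℝ) (s : S) :
    (policyMatrix p d *ᵥ α) s = ∑ a, d s a * ∑ s', p s a s' * α s' := by
  simp only [policyMatrix, mulVec, dotProduct, of_apply, sum_mul, mul_sum]
  rw [sum_comm]
  exact sum_congr rfl fun a _ => sum_congr rfl fun s' _ => by ring

lemma policyMatrix_vertex_mulVec [DecidableEq A] (p : Kernel S A) (d : S → A) (α : S → ℝ) (s : S) :
    (policyMatrix p (fun s => stdSimplex.vertex (d s)) *ᵥ α) s = ∑ s', p s (d s) s' * α s' := by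
  rw [policyMatrix_mulVec, sum_eq_single (d s)]
  · simp
  · intro a _ ha
    simp [Pi.single_eq_of_ne ha]
  · simp

variable [DecidableEq S]

lemma policyMatrix_mem_rowStochastic (p : Kernel S A) (d : S → stdSimplex ℝ A) :
    policyMatrix p d ∈ rowStochastic ℝ S := by
  refine mem_rowStochastic_iff_sum.2 ⟨fun s s' => ?_, fun s => ?_⟩
  · exact sum_nonneg fun a _ =>
      mul_nonneg (stdSimplex.zero_le (p s a) s') (stdSimplex.zero_le (d s) a)
  · simp only [policyMatrix, of_apply]
    rw [sum_comm]
    simp_rw [← sum_mul, stdSimplex.sum_eq_one, one_mul]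
    exact stdSimplex.sum_eq_one _

/-- A function which is the maximum over the actions of its one-step averages is constant. -/
lemma eq_of_isWeaklyCommunicating [DecidableEq A] [Nonempty A] {Q : Set (stdSimplex ℝ A)}
    (hQ : ∀ a : A, stdSimplex.vertex a ∈ Q) {p : Kernel S A} (hp : IsWeaklyCommunicating Q p)
    {α : S → ℝ}
    (hα : ∀ s, α s = univ.sup' univ_nonempty fun a : A => ∑ s', p s a s' * α s') (s t : S) :
    α s = α t := by
  have : Nonempty S := ⟨s⟩
  obtain ⟨C, hcomm, htrans⟩ := hp
  simp_rw [eq_univ_sup'_iff] at hα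
  choose hle d hd using hα
  -- The greedy policy, for which `α` is harmonic.
  set D : S → stdSimplex ℝ A := fun s => stdSimplex.vertex (d s) with hD
  have hDQ : ∀ s, D s ∈ Q := fun s => hQ (d s)
  have hharm : ∀ s, (policyMatrix p D *ᵥ α) s = α s := fun s => by
    rw [hD, policyMatrix_vertex_mulVec, ← hd s]
  have hstoch := policyMatrix_mem_rowStochastic p D
  have hmemC : ∀ x, ¬ IsTransient (policyMatrix p D) x → x ∈ C := fun x hx => by
    by_contra hxC
    exact hx (htrans x hxC D hDQ)
  obtain ⟨m, hm⟩ := Finite.exists_min α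
  obtain ⟨M, hM⟩ := Finite.exists_max α
  obtain ⟨c, hc, n, hn⟩ := exists_not_isTransient hstoch m
  obtain ⟨c', hc', n', hn'⟩ := exists_not_isTransient hstoch M
  have hcm : α c = α m := eq_of_superharmonic_of_pos hstoch (fun s => (hharm s).le) hm hn
  have hcM : -α c' = -α M :=
    eq_of_superharmonic_of_pos (α := -α) hstoch
      (fun s => by rw [mulVec_neg, Pi.neg_apply, Pi.neg_apply, hharm s])
      (fun x => neg_le_neg (hM x)) hn'
  obtain ⟨Δ, -, N, -, hN⟩ := hcomm c (hmemC c hc) c' (hmemC c' hc')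
  have hcc' : α c' = α c :=
    eq_of_superharmonic_of_pos (policyMatrix_mem_rowStochastic p Δ)
      (fun s => by
        rw [policyMatrix_mulVec]
        exact average_le (Δ s) (hle s))
      (fun x => hcm ▸ hm x) hN
  linarith [hm s, hm t, hM s, hM t]

end Rigidity

/-! ### The constant-gain equation -/

section ConstantGain

variable {S A : Type*} [Fintype S]

/-- Maximum principle: the gain of a subsolution is at most the gain of a supersolution. -/
lemma gain_le_gain [Nonempty S] {r : S → A → ℝ} {p : Kernel S A} {g g' : ℝ} {v v' : S → ℝ}
    (hsub : ∀ s, ∃ a, v s ≤ r s a - g + ∑ s', p s a s' * v s')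
    (hsuper : ∀ s a, r s a - g' + ∑ s', p s a s' * v' s' ≤ v' s) : g ≤ g' := by
  obtain ⟨s, hs⟩ := Finite.exists_max fun s => v s - v' s
  obtain ⟨a, ha⟩ := hsub s
  have h1 := hsuper s a
  have h2 := average_le (p s a) hs
  simp_rw [mul_sub] at h2
  rw [sum_sub_distrib] at h2
  linarith

variable [Fintype A] [Nonempty A] {r : S → A → ℝ} {p : Kernel S A}

lemma SolvesConstantGain.gain_unique [Nonempty S] {g g' : ℝ} {v v' : S → ℝ}
    (h : SolvesConstantGain r p g v) (h' : SolvesConstantGain r p g' v') : g = g' := by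
  simp only [SolvesConstantGain, eq_univ_sup'_iff] at h h'
  exact le_antisymm
    (gain_le_gain (fun s => (h s).2.imp fun _ e => e.le) fun s => (h' s).1)
    (gain_le_gain (fun s => (h' s).2.imp fun _ e => e.le) fun s => (h s).1)

lemma SolvesConstantGain.abs_gain_sub_le [Nonempty S] {p' : Kernel S A} {g g' ε : ℝ}
    {v v' : S → ℝ} (h : SolvesConstantGain r p g v) (h' : SolvesConstantGain r p' g' v')
    (hε : ∀ s a, |∑ s', (p' s a s' - p s a s') * v s'| ≤ ε) : |g' - g| ≤ ε := by
  simp only [SolvesConstantGain, eq_univ_sup'_iff] at h h'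
  simp_rw [sub_mul, sum_sub_distrib, abs_sub_le_iff] at hε
  have h1 : g' ≤ g + ε := by
    refine gain_le_gain (v' := v) (fun s => (h' s).2.imp fun _ e => e.le) fun s a => ?_
    linarith [(h s).1 a, (hε s a).1]
  have h2 : g - ε ≤ g' := by
    refine gain_le_gain (v := v) (fun s => ?_) fun s => (h' s).1
    obtain ⟨a, ha⟩ := (h s).2
    exact ⟨a, by linarith [(hε s a).2]⟩
  rw [abs_sub_le_iff]
  constructor <;> linarith

lemma SolvesConstantGain.solvesMultichain {g : ℝ} {v : S → ℝ} (h : SolvesConstantGain r p g v) :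
    SolvesMultichain r p (fun _ => g) v :=
  fun s => ⟨by simp_rw [average_const]; rw [sup'_const], h s⟩

lemma exists_discounted_solution (r : S → A → ℝ) (p : Kernel S A) {β : ℝ} (hβ0 : 0 ≤ β)
    (hβ1 : β < 1) : ∃ v : S → ℝ, ∀ s,
      v s = univ.sup' univ_nonempty fun a : A => r s a + β * ∑ s', p s a s' * v s' := by
  have hT : ContractingWith ⟨β, hβ0⟩ fun (v : S → ℝ) (s : S) =>
      univ.sup' univ_nonempty fun a : A => r s a + β * ∑ s', p s a s' * v s' := by
    refine ⟨hβ1, LipschitzWith.of_dist_le_mul fun v w => ?_⟩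
    refine (dist_pi_le_iff (by positivity)).2 fun s => ?_
    rw [Real.dist_eq]
    refine abs_univ_sup'_sub_le fun a => ?_
    rw [add_sub_add_left_eq_sub, ← mul_sub, ← sum_sub_distrib, abs_mul, abs_of_nonneg hβ0]
    simp_rw [← mul_sub]
    refine mul_le_mul_of_nonneg_left (abs_average_le _ fun s' => ?_) hβ0
    rw [← Real.dist_eq]
    exact dist_le_pi_dist v w s'
  exact ⟨hT.fixedPoint, fun s => (congrFun hT.fixedPoint_isFixedPt s).symm⟩

/-- The discounted solution centred at `s₀`; the centring constant `g = (1 - β) v(s₀)` is bounded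
independently of the discount factor. -/
lemma exists_centred_discounted_solution (p : Kernel S A) (s₀ : S)
    {R : ℝ} (hR : ∀ s a, |r s a| ≤ R) {β : ℝ} (hβ0 : 0 ≤ β) (hβ1 : β < 1) :
    ∃ (g : ℝ) (h : S → ℝ), |g| ≤ R ∧ h s₀ = 0 ∧ ∀ s,
      h s = univ.sup' univ_nonempty fun a : A => r s a - g + β * ∑ s', p s a s' * h s' := by
  obtain ⟨v, hv⟩ := exists_discounted_solution r p hβ0 hβ1
  simp_rw [eq_univ_sup'_iff] at hv
  have hR0 : 0 ≤ R := (abs_nonneg _).trans (hR s₀ (Classical.arbitrary A))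
  have hnorm : ‖v‖ ≤ R + β * ‖v‖ := by
    refine (pi_norm_le_iff_of_nonneg (by positivity)).2 fun s => ?_
    obtain ⟨a, ha⟩ := (hv s).2
    rw [ha, Real.norm_eq_abs]
    refine (abs_add_le _ _).trans (add_le_add (hR s a) ?_)
    rw [abs_mul, abs_of_nonneg hβ0]
    exact mul_le_mul_of_nonneg_left (abs_average_le _ fun s' => norm_le_pi_norm v s') hβ0
  refine ⟨(1 - β) * v s₀, fun s => v s - v s₀, ?_, sub_self _, fun s => ?_⟩
  · rw [abs_mul, abs_of_nonneg (by linarith)]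
    have : |v s₀| ≤ ‖v‖ := norm_le_pi_norm v s₀
    nlinarith
  · have havg : ∀ a, ∑ s', p s a s' * (v s' - v s₀) = (∑ s', p s a s' * v s') - v s₀ := fun a => by
      simp_rw [mul_sub]
      rw [sum_sub_distrib, average_const]
    simp_rw [eq_univ_sup'_iff, havg]
    refine ⟨fun a => ?_, ?_⟩
    · linarith [(hv s).1 a]
    · obtain ⟨a, ha⟩ := (hv s).2
      exact ⟨a, by linarith⟩

/-- A limit of rescaled centred discounted solutions as the discount factor tends to one. -/
lemma exists_rescaled_solution (r : S → A → ℝ) (p : Kernel S A) (s₀ : S) :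
    ∃ (κ g : ℝ) (w : S → ℝ), w s₀ = 0 ∧ (κ = 1 ∨ ‖w‖ = 1) ∧ 0 ≤ κ ∧ ∀ s,
      w s = univ.sup' univ_nonempty fun a : A => κ * (r s a - g) + ∑ s', p s a s' * w s' := by
  obtain ⟨R, hR⟩ : ∃ R, ∀ s a, |r s a| ≤ R :=
    ⟨‖r‖, fun s a => (norm_le_pi_norm (r s) a).trans (norm_le_pi_norm r s)⟩
  -- The rescaled solutions `(β, κ, g, w)` for all discount factors `β ∈ [0, 1]`.
  set Z : Set (ℝ × ℝ × ℝ × (S → ℝ)) :=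
    (Set.Icc 0 1 ×ˢ Set.Icc 0 1 ×ˢ Set.Icc (-R) R ×ˢ Metric.closedBall 0 1) ∩
      ({z | z.2.2.2 s₀ = 0} ∩ (({z | z.2.1 = 1} ∪ {z | ‖z.2.2.2‖ = 1}) ∩ ⋂ s,
        {z | z.2.2.2 s = univ.sup' univ_nonempty fun a : A =>
          z.2.1 * (r s a - z.2.2.1) + z.1 * ∑ s', p s a s' * z.2.2.2 s'})) with hZ
  have hZcompact : IsCompact Z := by
    refine (isCompact_Icc.prod (isCompact_Icc.prod
      (isCompact_Icc.prod (isCompact_closedBall _ _)))).inter_right ?_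
    refine (isClosed_eq (by fun_prop) (by fun_prop)).inter (IsClosed.inter
      ((isClosed_eq (by fun_prop) (by fun_prop)).union
        (isClosed_eq (by fun_prop) (by fun_prop))) ?_)
    refine isClosed_iInter fun s => isClosed_eq (by fun_prop) ?_
    exact Continuous.finset_sup'_apply _ fun a _ => by fun_prop
  have hsubset : Set.Ico (0 : ℝ) 1 ⊆ Prod.fst '' Z := by
    rintro β ⟨hβ0, hβ1⟩
    obtain ⟨g, h, hg, h0, hh⟩ := exists_centred_discounted_solution p s₀ hR hβ0 hβ1
    have hK : 0 < max 1 ‖h‖ := by positivity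
    refine ⟨(β, (max 1 ‖h‖)⁻¹, g, (max 1 ‖h‖)⁻¹ • h), ⟨⟨⟨hβ0, hβ1.le⟩, ⟨by positivity, ?_⟩,
      abs_le.1 hg, ?_⟩, ?_, ?_, Set.mem_iInter.2 fun s => ?_⟩, rfl⟩
    · exact inv_le_one_of_one_le₀ (le_max_left _ _)
    · rw [mem_closedBall_zero_iff, norm_smul, Real.norm_of_nonneg (by positivity),
        inv_mul_le_one₀ hK]
      exact le_max_right _ _
    · change (max 1 ‖h‖)⁻¹ * h s₀ = 0
      rw [h0, mul_zero]
    · rcases le_total ‖h‖ 1 with h1 | h1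
      · simp [max_eq_left h1]
      · right
        have : ‖h‖ ≠ 0 := by linarith
        simp [norm_smul, max_eq_right h1, this]
    · have hs := hh s
      refine eq_univ_sup'_iff.2 ?_
      rw [eq_univ_sup'_iff] at hs
      have hscale : ∀ a, (max 1 ‖h‖)⁻¹ * (r s a - g) +
          β * ∑ s', p s a s' * ((max 1 ‖h‖)⁻¹ • h) s' =
          (max 1 ‖h‖)⁻¹ * (r s a - g + β * ∑ s', p s a s' * h s') := fun a => by
        simp only [Pi.smul_apply, smul_eq_mul, mul_left_comm _ (max 1 ‖h‖)⁻¹, ← mul_sum]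
        ring
      refine ⟨fun a => ?_, ?_⟩
      · exact (hscale a).trans_le (mul_le_mul_of_nonneg_left (hs.1 a) (by positivity))
      · obtain ⟨a, ha⟩ := hs.2
        exact ⟨a, by rw [hscale a, ← ha]; rfl⟩
  have h1 : (1 : ℝ) ∈ Prod.fst '' Z := by
    have hclosed : IsClosed (Prod.fst '' Z) := (hZcompact.image continuous_fst).isClosed
    refine hclosed.closure_subset_iff.2 hsubset ?_
    rw [closure_Ico zero_ne_one]
    exact ⟨zero_le_one, le_rfl⟩
  obtain ⟨⟨β, κ, g, w⟩, ⟨⟨-, hκ, -⟩, hw0, hκw, hw⟩, rfl⟩ := h1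
  exact ⟨κ, g, w, hw0, hκw, hκ.1, fun s => by simpa using Set.mem_iInter.1 hw s⟩

variable [DecidableEq S] [DecidableEq A] {Q : Set (stdSimplex ℝ A)}

lemma exists_solvesConstantGain [Nonempty S] (hQ : ∀ a : A, stdSimplex.vertex a ∈ Q)
    (hp : IsWeaklyCommunicating Q p) : ∃ (g : ℝ) (v : S → ℝ), SolvesConstantGain r p g v := by
  obtain ⟨κ, g, w, hw0, hκw, hκ0, hw⟩ := exists_rescaled_solution r p (Classical.arbitrary S)
  rcases hκ0.eq_or_lt with rfl | hκ
  · -- The degenerate limit `κ = 0` contradicts rigidity.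
    have hzero : w = 0 := funext fun s =>
      (eq_of_isWeaklyCommunicating hQ hp (by simpa using hw) s _).trans hw0
    simp [hzero] at hκw
  · refine ⟨g, κ⁻¹ • w, fun s => ?_⟩
    have hs := hw s
    rw [eq_univ_sup'_iff] at hs ⊢
    have hscale : ∀ a, r s a - g + ∑ s', p s a s' * (κ⁻¹ • w) s' =
        κ⁻¹ * (κ * (r s a - g) + ∑ s', p s a s' * w s') := fun a => by
      simp only [Pi.smul_apply, smul_eq_mul, mul_left_comm _ κ⁻¹, ← mul_sum]
      field_simp
    refine ⟨fun a => ?_, ?_⟩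
    · exact (hscale a).trans_le (mul_le_mul_of_nonneg_left (hs.1 a) (by positivity))
    · obtain ⟨a, ha⟩ := hs.2
      exact ⟨a, by rw [hscale a, ← ha]; rfl⟩

/-! ### The multichain equation -/

lemma SolvesMultichain.exists_solvesConstantGain [Nonempty S]
    (hQ : ∀ a : A, stdSimplex.vertex a ∈ Q) (hp : IsWeaklyCommunicating Q p) {α v : S → ℝ}
    (h : SolvesMultichain r p α v) :
    ∃ g : ℝ, α = (fun _ => g) ∧ SolvesConstantGain r p g v := by
  have hα := eq_of_isWeaklyCommunicating hQ hp fun s => (h s).1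
  refine ⟨α (Classical.arbitrary S), funext fun s => hα s _, fun s => ?_⟩
  rw [hα (Classical.arbitrary S) s]
  exact (h s).2

lemma SolvesConstantGain.eq_of_solvesMultichain [Nonempty S]
    (hQ : ∀ a : A, stdSimplex.vertex a ∈ Q) (hp : IsWeaklyCommunicating Q p) {g : ℝ}
    {v α v' : S → ℝ} (h : SolvesConstantGain r p g v) (h' : SolvesMultichain r p α v') :
    α = fun _ => g := by
  obtain ⟨g', rfl, hg'⟩ := h'.exists_solvesConstantGain hQ hp
  rw [h.gain_unique hg']

lemma SolvesConstantGain.optimalGain_eq [Nonempty S]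
    (hQ : ∀ a : A, stdSimplex.vertex a ∈ Q) (hp : IsWeaklyCommunicating Q p) {g : ℝ}
    {v : S → ℝ} (h : SolvesConstantGain r p g v) : optimalGain r p = fun _ => g := by
  have hex : ∃ α : S → ℝ, ∃ v : S → ℝ, SolvesMultichain r p α v := ⟨_, v, h.solvesMultichain⟩
  rw [optimalGain, dif_pos hex]
  exact h.eq_of_solvesMultichain hQ hp hex.choose_spec.choose_spec

lemma continuousOn_optimalGain [Nonempty S] (hQ : ∀ a : A, stdSimplex.vertex a ∈ Q)
    {U : Set (Kernel S A)} (hwc : ∀ p ∈ U, IsWeaklyCommunicating Q p) :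
    ContinuousOn (fun p => optimalGain r p) U := by
  refine continuousOn_pi.2 fun s => ?_
  intro p hp
  obtain ⟨g, v, h⟩ := exists_solvesConstantGain (r := r) hQ (hwc p hp)
  set E : Kernel S A → ℝ := fun p' => ∑ s, ∑ a, |∑ s', (p' s a s' - p s a s') * v s'| with hE
  have hEcont : Continuous E := by
    have happly : ∀ (s : S) (a : A) (s' : S), Continuous fun p' : Kernel S A => p' s a s' :=
      fun s a s' => (continuous_apply s').comp
        (continuous_subtype_val.comp ((continuous_apply a).comp (continuous_apply s)))
    exact continuous_finsetSum _ fun s _ => continuous_finsetSum _ fun a _ =>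
      (continuous_finsetSum _ fun s' _ =>
        ((happly s a s').sub continuous_const).mul continuous_const).abs
  have hE0 : Tendsto E (𝓝[U] p) (𝓝 0) := by
    have := (hEcont.tendsto p).mono_left (nhdsWithin_le_nhds (s := U))
    simpa [hE] using this
  refine tendsto_iff_dist_tendsto_zero.2 (squeeze_zero' (Eventually.of_forall fun _ => dist_nonneg)
    ?_ hE0)
  filter_upwards [self_mem_nhdsWithin] with p' hp'
  obtain ⟨g', v', h'⟩ := exists_solvesConstantGain (r := r) hQ (hwc p' hp')
  rw [h.optimalGain_eq hQ (hwc p hp), h'.optimalGain_eq hQ (hwc p' hp'), Real.dist_eq]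
  refine h.abs_gain_sub_le h' fun s a => ?_
  exact (single_le_sum (f := fun a => |∑ s', (p' s a s' - p s a s') * v s'|)
      (fun _ _ => abs_nonneg _) (mem_univ a)).trans
    (single_le_sum (f := fun s => ∑ a, |∑ s', (p' s a s' - p s a s') * v s'|)
      (fun _ _ => sum_nonneg fun _ _ => abs_nonneg _) (mem_univ s))

end ConstantGain

end RobustMDP

/-! ### Gain and worst-case kernel -/

theorem mainTheorem9 {S A : Type*} [Fintype S] [DecidableEq S] [Nonempty S]
    [Fintype A] [DecidableEq A] [Nonempty A]
    (r : S → A → ℝ) (Q : Set (stdSimplex ℝ A))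
    (hQ : ∀ a : A, stdSimplex.vertex a ∈ Q)
    (U : Set (RobustMDP.Kernel S A)) (hne : U.Nonempty) (hcompact : IsCompact U)
    (hwc : ∀ p ∈ U, RobustMDP.IsWeaklyCommunicating Q p) :
    -- on `U` the gain is well defined, unique and state independent
    (∀ p ∈ U, ∃ g : ℝ, (∀ s, RobustMDP.optimalGain r p s = g) ∧
      (∃ v : S → ℝ, RobustMDP.SolvesConstantGain r p g v) ∧
      (∀ (g' : ℝ) (v : S → ℝ), RobustMDP.SolvesConstantGain r p g' v → g' = g) ∧
      (∃ v : S → ℝ, RobustMDP.SolvesMultichain r p (RobustMDP.optimalGain r p) v) ∧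
      ∀ α v : S → ℝ, RobustMDP.SolvesMultichain r p α v → α = RobustMDP.optimalGain r p) ∧
    -- continuity of the gain
    ContinuousOn (fun p => RobustMDP.optimalGain r p) U ∧
    -- existence of a worst-case kernel
    ∃ pstar ∈ U,
      (∀ s, IsLeast ((fun p => RobustMDP.optimalGain r p s) '' U)
        (RobustMDP.optimalGain r pstar s)) ∧
      ∀ μ : stdSimplex ℝ S,
        IsLeast (RobustMDP.meanGain r μ '' U) (RobustMDP.meanGain r μ pstar) ∧
        RobustMDP.meanGain r μ pstar = RobustMDP.robustGain r U μ := by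
  have hopt : ∀ p ∈ U, ∃ (g : ℝ) (v : S → ℝ), RobustMDP.SolvesConstantGain r p g v ∧
      RobustMDP.optimalGain r p = fun _ => g := fun p hp => by
    obtain ⟨g, v, h⟩ := RobustMDP.exists_solvesConstantGain (r := r) hQ (hwc p hp)
    exact ⟨g, v, h, h.optimalGain_eq hQ (hwc p hp)⟩
  have hcont := RobustMDP.continuousOn_optimalGain (r := r) hQ hwc
  refine ⟨fun p hp => ?_, hcont, ?_⟩
  · obtain ⟨g, v, h, hg⟩ := hopt p hp
    refine ⟨g, fun s => congrFun hg s, ⟨v, h⟩, fun g' v' h' => h'.gain_unique h,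
      ⟨v, hg ▸ h.solvesMultichain⟩, fun α v' h' => ?_⟩
    rw [hg]
    exact h.eq_of_solvesMultichain hQ (hwc p hp) h'
  · obtain ⟨s₀⟩ := ‹Nonempty S›
    obtain ⟨pstar, hps, hmin⟩ := hcompact.exists_isMinOn hne (continuousOn_pi.1 hcont s₀)
    -- Gains do not depend on the state, so minimality at `s₀` gives minimality at every state.
    have hle : ∀ p ∈ U, ∀ s, RobustMDP.optimalGain r pstar s ≤ RobustMDP.optimalGain r p s :=
      fun p hp s => by
        obtain ⟨g, -, -, hg⟩ := hopt p hp
        obtain ⟨g', -, -, hg'⟩ := hopt pstar hps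
        have := hmin hp
        simpa [hg, hg'] using this
    refine ⟨pstar, hps, fun s => ⟨⟨pstar, hps, rfl⟩, ?_⟩, fun μ => ?_⟩
    · rintro _ ⟨p, hp, rfl⟩
      exact hle p hp s
    · have hleast : IsLeast (RobustMDP.meanGain r μ '' U) (RobustMDP.meanGain r μ pstar) := by
        refine ⟨⟨pstar, hps, rfl⟩, ?_⟩
        rintro _ ⟨p, hp, rfl⟩
        exact RobustMDP.average_mono μ (hle p hp)
      exact ⟨hleast, hleast.csInf_eq.symm⟩
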